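/- Let $q\in\mathbb C$ be a primitive $n$-th root of unity with $n\ge 3$, $n\ne 4$, and let $d=n$ if $n$ is odd, $d=n/2$ if $n$ is even. Let $\mathrm u_q=\mathrm u_q(\mathfrak{sl}_2(\mathbb C))$ be the $\mathbb C$-algebra with generators $E,F,K$ and relations $$E^d=F^d=0,\quad K^d=1,\quad KE=q^2EK,\quad KF=q^{-2}FK,\quad EF-FE=\frac{K-K^{-1}}{q-q^{-1}},$$ and let it act on tensor products over $\mathbb C$ of $\mathrm u_q$-modules through the comultiplication $\Delta(E)=1\otimes E+E\otimes K$, $\Delta(F)=K^{-1}\otimes F+F\otimes 1$, $\Delta(K)=K\otimes K$. Let $\mathrm u_q^+$ be the subalgebra generated by $E$ and $K$. For $i\in\mathbb Z/d\mathbb Z$ and $0\le u\le d-1$ let $M_i^u$ be the $\mathrm u_q^+$-module with basis $e^0,\dots,e^u$ and action $Ke^k=q^{2(i+k)}e^k$, $Ee^k=e^{k+1}$ for $k<u$, $Ee^u=0$. Denote by $\overline M_i^u$ a simple $\mathrm u_q$-module whose restriction to $\mathrm u_q^+$ is isomorphic to $M_i^u$, when there is one. **Theorem.** Let $i,j\in\mathbb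 Z/d\mathbb Z$ and let $0\le v\le u$ be integers with $u+v\le d-1$, and let $\overline M_i^u$ and $\overline M_j^v$ be simple $\mathrm u_q$-modules as above. Then for every $0\le l\le v$ a simple module $\overline M_{i+j+l}^{u+v-2l}$ exists, and, for any choice of these modules, there is an isomorphism of $\mathrm u_q$-modules $$\overline M_i^u\otimes\overline M_j^v\;\cong\;\bigoplus_{l=0}^{v}\overline M_{i+j+l}^{u+v-2l}.$$ -/

import Mathlib

open scoped TensorProduct DirectSum

namespace SmallQuantum

/-- The integer `d` attached to `n`: it is `n` if `n` is odd and `n / 2` if `n` is even. -/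
def dOf (n : ℕ) : ℕ := if Odd n then n else n / 2

/-- The three generators of the small quantum group. -/
inductive Gen : Type
  | E
  | F
  | K

/-- The generator `g` in the free algebra. -/
noncomputable abbrev fr (g : Gen) : FreeAlgebra ℂ Gen := FreeAlgebra.ι ℂ g

/-- The defining relations of `u_q(sl₂(ℂ))`. Since `K ^ d = 1` is imposed (and `d ≥ 1` for `n ≥ 2`),
the element `K ^ (d - 1)` is the inverse of `K`. -/
inductive Rel (q : ℂ) (n : ℕ) : FreeAlgebra ℂ Gen → FreeAlgebra ℂ Gen → Prop
  | E_pow : Rel q n (fr Gen.E ^ dOf n) 0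
  | F_pow : Rel q n (fr Gen.F ^ dOf n) 0
  | K_pow : Rel q n (fr Gen.K ^ dOf n) 1
  | K_E : Rel q n (fr Gen.K * fr Gen.E) (q ^ 2 • (fr Gen.E * fr Gen.K))
  | K_F : Rel q n (fr Gen.K * fr Gen.F) ((q ^ 2)⁻¹ • (fr Gen.F * fr Gen.K))
  | E_F : Rel q n (fr Gen.E * fr Gen.F - fr Gen.F * fr Gen.E)
      ((q - q⁻¹)⁻¹ • (fr Gen.K - fr Gen.K ^ (dOf n - 1)))

/-- The algebra `u_q = u_q(sl₂(ℂ))`, presented by generators and relations. -/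
abbrev Uq (q : ℂ) (n : ℕ) : Type := RingQuot (Rel q n)

/-- The class in `u_q` of a generator. -/
noncomputable def gen (q : ℂ) (n : ℕ) (g : Gen) : Uq q n :=
  RingQuot.mkAlgHom ℂ (Rel q n) (fr g)

/-- The generator `E` of `u_q`. -/
noncomputable abbrev E (q : ℂ) (n : ℕ) : Uq q n := gen q n Gen.E

/-- The generator `F` of `u_q`. -/
noncomputable abbrev F (q : ℂ) (n : ℕ) : Uq q n := gen q n Gen.F

/-- The generator `K` of `u_q`. -/
noncomputable abbrev K (q : ℂ) (n : ℕ) : Uq q n := gen q n Gen.K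

/-- The inverse of `K` in `u_q`. -/
noncomputable abbrev Kinv (q : ℂ) (n : ℕ) : Uq q n := K q n ^ (dOf n - 1)

section relations

variable (q : ℂ) (n : ℕ)

theorem E_pow : E q n ^ dOf n = 0 := by
  simpa [gen] using RingQuot.mkAlgHom_rel ℂ (Rel.E_pow (q := q) (n := n))

theorem F_pow : F q n ^ dOf n = 0 := by
  simpa [gen] using RingQuot.mkAlgHom_rel ℂ (Rel.F_pow (q := q) (n := n))

theorem K_pow : K q n ^ dOf n = 1 := by
  simpa [gen] using RingQuot.mkAlgHom_rel ℂ (Rel.K_pow (q := q) (n := n))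

theorem K_mul_E : K q n * E q n = q ^ 2 • (E q n * K q n) := by
  simpa [gen] using RingQuot.mkAlgHom_rel ℂ (Rel.K_E (q := q) (n := n))

theorem K_mul_F : K q n * F q n = (q ^ 2)⁻¹ • (F q n * K q n) := by
  simpa [gen] using RingQuot.mkAlgHom_rel ℂ (Rel.K_F (q := q) (n := n))

theorem E_mul_F_sub : E q n * F q n - F q n * E q n = (q - q⁻¹)⁻¹ • (K q n - Kinv q n) := by
  simpa [gen, Kinv] using RingQuot.mkAlgHom_rel ℂ (Rel.E_F (q := q) (n := n))

end relations

/-! Facts needed to see that the comultiplication is well defined. -/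

/-- Gaussian binomial coefficients, by the Pascal rule. -/
noncomputable def gauss (z : ℂ) : ℕ → ℕ → ℂ
  | _, 0 => 1
  | 0, _ + 1 => 0
  | m + 1, k + 1 => gauss z m k + z ^ (k + 1) * gauss z m (k + 1)

theorem gauss_eq_zero (z : ℂ) : ∀ {m k : ℕ}, m < k → gauss z m k = 0
  | _, 0, h => absurd h (Nat.not_lt_zero _)
  | 0, _ + 1, _ => rfl
  | m + 1, k + 1, h => by
    rw [gauss, gauss_eq_zero z (by omega : m < k), gauss_eq_zero z (by omega : m < k + 1)]
    simp

/-- In an algebra with `y x = z x y`, the noncommutative binomial formula. -/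
theorem add_pow_gauss {A : Type*} [Ring A] [Algebra ℂ A] (z : ℂ) (x y : A)
    (h : y * x = z • (x * y)) (m : ℕ) :
    (x + y) ^ m = ∑ k ∈ Finset.range (m + 1), gauss z m k • (x ^ k * y ^ (m - k)) := by
  have hk : ∀ k : ℕ, y * x ^ k = z ^ k • (x ^ k * y) := by
    intro k
    induction k with
    | zero => simp
    | succ k ih =>
      rw [pow_succ, ← mul_assoc, ih, smul_mul_assoc, mul_assoc, h, mul_smul_comm, smul_smul,
        ← pow_succ, mul_assoc]
  induction m with
  | zero => simp [gauss]
  | succ m ih =>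
    rw [pow_succ', ih, add_mul, Finset.sum_range_succ' _ (m + 1), Finset.mul_sum, Finset.mul_sum]
    have h1 : ∀ k ∈ Finset.range (m + 1),
        gauss z (m + 1) (k + 1) • (x ^ (k + 1) * y ^ (m + 1 - (k + 1))) =
        x * (gauss z m k • (x ^ k * y ^ (m - k))) +
          (z ^ (k + 1) * gauss z m (k + 1)) • (x ^ (k + 1) * y ^ (m - k)) := by
      intro k _
      rw [gauss, add_smul, mul_smul_comm, ← mul_assoc, ← pow_succ', Nat.add_sub_add_right]
    rw [Finset.sum_congr rfl h1, Finset.sum_add_distrib, add_assoc]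
    congr 1
    have h2 : ∀ k ∈ Finset.range (m + 1), y * (gauss z m k • (x ^ k * y ^ (m - k))) =
        (z ^ k * gauss z m k) • (x ^ k * y ^ (m + 1 - k)) := by
      intro k hk'
      have : m + 1 - k = (m - k) + 1 := by
        have := Finset.mem_range.1 hk'
        omega
      rw [mul_smul_comm, ← mul_assoc, hk, smul_mul_assoc, smul_smul, mul_assoc, ← pow_succ', this,
        mul_comm]
    rw [Finset.sum_congr rfl h2, Finset.sum_range_succ' _ m, Finset.sum_range_succ _ m,
      gauss_eq_zero z (Nat.lt_succ_self m)]
    simp [gauss]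

theorem gauss_step (z : ℂ) : ∀ m k : ℕ, k ≤ m →
    (z ^ (k + 1) - 1) * gauss z m (k + 1) = (z ^ (m - k) - 1) * gauss z m k
  | 0, k, hk => by
    obtain rfl : k = 0 := by omega
    simp [gauss]
  | m + 1, 0, _ => by
    have h := gauss_step z m 0 (Nat.zero_le m)
    simp only [gauss, Nat.sub_zero, zero_add, pow_one] at h ⊢
    linear_combination z * h
  | m + 1, k + 1, hk => by
    have h := gauss_step z m k (by omega)
    rcases Nat.lt_or_ge k m with hkm | hkm
    · have h' := gauss_step z m (k + 1) (by omega)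
      obtain ⟨r, rfl⟩ : ∃ r, m = k + 1 + r := ⟨m - (k + 1), by omega⟩
      have e1 : k + 1 + r - k = r + 1 := by omega
      have e2 : k + 1 + r - (k + 1) = r := by omega
      have e3 : k + 1 + r + 1 - (k + 1) = r + 1 := by omega
      rw [e1] at h
      rw [e2] at h'
      rw [e3]
      simp only [gauss]
      linear_combination z ^ (k + 2) * h' + h
    · obtain rfl : k = m := by omega
      rw [gauss_eq_zero z (Nat.lt_succ_self (k + 1))]
      simp

theorem add_pow_eq_zero {A : Type*} [Ring A] [Algebra ℂ A] {z : ℂ} {d : ℕ}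
    (hz : IsPrimitiveRoot z d) (hd : 0 < d) {x y : A}
    (h : y * x = z • (x * y)) (hx : x ^ d = 0) (hy : y ^ d = 0) : (x + y) ^ d = 0 := by
  rw [add_pow_gauss z x y h]
  refine Finset.sum_eq_zero fun k hk => ?_
  rcases Nat.eq_zero_or_pos k with rfl | hk0
  · simp [hy]
  rcases Nat.lt_or_ge k d with hkd | hkd
  · obtain ⟨k, rfl⟩ : ∃ k', k = k' + 1 := ⟨k - 1, by omega⟩
    obtain ⟨m, rfl⟩ : ∃ m, d = m + 1 := ⟨d - 1, by omega⟩
    have hs := gauss_step z m k (by omega)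
    have e : z ^ (k + 1) * z ^ (m - k) = 1 := by
      rw [← pow_add, ← hz.pow_eq_one]
      congr 1
      omega
    have h0 : (z ^ (k + 1) - 1) * gauss z (m + 1) (k + 1) = 0 := by
      simp only [gauss]
      linear_combination z ^ (k + 1) * hs + gauss z m k * e
    have hne : z ^ (k + 1) - 1 ≠ 0 :=
      sub_ne_zero.2 (hz.pow_ne_one_of_pos_of_lt (by omega) hkd)
    rw [(mul_eq_zero.1 h0).resolve_left hne, zero_smul]
  · obtain rfl : k = d := by
      have := Finset.mem_range.1 hk
      omega
    simp [hx]

theorem dOf_pos {n : ℕ} (hn : 3 ≤ n) : 0 < dOf n := by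
  unfold dOf
  split_ifs <;> omega

theorem isPrimitiveRoot_sq {q : ℂ} {n : ℕ} (hq : IsPrimitiveRoot q n) (hn : 3 ≤ n) :
    IsPrimitiveRoot (q ^ 2) (dOf n) := by
  unfold dOf
  split_ifs with h
  · exact hq.pow_of_coprime 2 h.coprime_two_left
  · have h2 : n = 2 * (n / 2) := by
      have := Nat.not_odd_iff_even.1 h
      obtain ⟨m, rfl⟩ := this
      omega
    exact hq.pow (by omega) h2

/-- The values of the comultiplication on the generators. -/
noncomputable def comulGen (q : ℂ) (n : ℕ) : Gen → Uq q n ⊗[ℂ] Uq q n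
  | Gen.E => 1 ⊗ₜ E q n + E q n ⊗ₜ K q n
  | Gen.F => Kinv q n ⊗ₜ F q n + F q n ⊗ₜ 1
  | Gen.K => K q n ⊗ₜ K q n

theorem comul_rel {q : ℂ} {n : ℕ} (hq : IsPrimitiveRoot q n) (hn : 3 ≤ n)
    ⦃a b : FreeAlgebra ℂ Gen⦄ (h : Rel q n a b) :
    FreeAlgebra.lift ℂ (comulGen q n) a = FreeAlgebra.lift ℂ (comulGen q n) b := by
  have hd : 0 < dOf n := dOf_pos hn
  have hz := isPrimitiveRoot_sq hq hn
  have hq2 : q ^ 2 ≠ 0 := hz.ne_zero hd.ne'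
  have hKK : K q n * Kinv q n = 1 := by
    rw [Kinv, ← pow_succ', Nat.sub_add_cancel hd, K_pow]
  have hKK' : Kinv q n * K q n = 1 := by
    rw [Kinv, ← pow_succ, Nat.sub_add_cancel hd, K_pow]
  have hKE := K_mul_E q n
  have hKF := K_mul_F q n
  have hEK : E q n * Kinv q n = q ^ 2 • (Kinv q n * E q n) := by
    calc E q n * Kinv q n = Kinv q n * (K q n * E q n) * Kinv q n := by
          rw [← mul_assoc, hKK', one_mul]
      _ = q ^ 2 • (Kinv q n * E q n) := by
          rw [hKE, mul_smul_comm, smul_mul_assoc, mul_assoc, mul_assoc, hKK, mul_one]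
  have hFK : F q n * Kinv q n = (q ^ 2)⁻¹ • (Kinv q n * F q n) := by
    calc F q n * Kinv q n = Kinv q n * (K q n * F q n) * Kinv q n := by
          rw [← mul_assoc, hKK', one_mul]
      _ = (q ^ 2)⁻¹ • (Kinv q n * F q n) := by
          rw [hKF, mul_smul_comm, smul_mul_assoc, mul_assoc, mul_assoc, hKK, mul_one]
  have hFK2 : Kinv q n * F q n = q ^ 2 • (F q n * Kinv q n) := by
    rw [hFK, smul_smul, mul_inv_cancel₀ hq2, one_smul]
  have hEF := E_mul_F_sub q n
  cases h with
  | E_pow =>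
    simp only [map_pow, FreeAlgebra.lift_ι_apply, comulGen, map_zero]
    refine add_pow_eq_zero (A := Uq q n ⊗[ℂ] Uq q n) (x := 1 ⊗ₜ E q n) (y := E q n ⊗ₜ K q n)
      hz hd ?_ ?_ ?_
    · simp only [Algebra.TensorProduct.tmul_mul_tmul, one_mul, mul_one, hKE,
        TensorProduct.tmul_smul]
    · rw [Algebra.TensorProduct.tmul_pow, E_pow, TensorProduct.tmul_zero]
    · rw [Algebra.TensorProduct.tmul_pow, E_pow, TensorProduct.zero_tmul]
  | F_pow =>
    simp only [map_pow, FreeAlgebra.lift_ι_apply, comulGen, map_zero]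
    rw [add_comm]
    refine add_pow_eq_zero (A := Uq q n ⊗[ℂ] Uq q n) (x := F q n ⊗ₜ 1) (y := Kinv q n ⊗ₜ F q n)
      hz hd ?_ ?_ ?_
    · simp only [Algebra.TensorProduct.tmul_mul_tmul, one_mul, mul_one, hFK2,
        TensorProduct.smul_tmul']
    · rw [Algebra.TensorProduct.tmul_pow, F_pow, TensorProduct.zero_tmul]
    · rw [Algebra.TensorProduct.tmul_pow, F_pow, TensorProduct.tmul_zero]
  | K_pow =>
    simp only [map_pow, FreeAlgebra.lift_ι_apply, comulGen, map_one]
    rw [Algebra.TensorProduct.tmul_pow, K_pow, Algebra.TensorProduct.one_def]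
  | K_E =>
    simp only [map_mul, map_smul, FreeAlgebra.lift_ι_apply, comulGen]
    simp only [mul_add, add_mul, Algebra.TensorProduct.tmul_mul_tmul, one_mul, mul_one, hKE,
      TensorProduct.tmul_smul, TensorProduct.smul_tmul', smul_add]
  | K_F =>
    simp only [map_mul, map_smul, FreeAlgebra.lift_ι_apply, comulGen]
    simp only [mul_add, add_mul, Algebra.TensorProduct.tmul_mul_tmul, one_mul, mul_one, hKF, hKK,
      hKK', TensorProduct.tmul_smul, TensorProduct.smul_tmul', smul_add]
  | E_F =>
    simp only [map_mul, map_sub, map_smul, map_pow, FreeAlgebra.lift_ι_apply, comulGen]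
    have hEF' : E q n * F q n = F q n * E q n + (q - q⁻¹)⁻¹ • (K q n - Kinv q n) := by
      rw [← hEF]
      abel
    simp only [mul_add, add_mul, Algebra.TensorProduct.tmul_mul_tmul, one_mul, mul_one,
      Algebra.TensorProduct.tmul_pow, hEK, hKF, hEF', TensorProduct.tmul_smul,
      TensorProduct.smul_tmul', smul_sub, TensorProduct.tmul_add, TensorProduct.add_tmul,
      TensorProduct.tmul_sub, TensorProduct.sub_tmul, smul_smul,
      inv_mul_cancel₀ hq2, one_smul]
    abel

/-- The comultiplication `Δ : u_q → u_q ⊗ u_q`. -/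
noncomputable def comul {q : ℂ} {n : ℕ} (hq : IsPrimitiveRoot q n) (hn : 3 ≤ n) :
    Uq q n →ₐ[ℂ] Uq q n ⊗[ℂ] Uq q n :=
  RingQuot.liftAlgHom ℂ ⟨FreeAlgebra.lift ℂ (comulGen q n), comul_rel hq hn⟩

section tensor

variable {q : ℂ} {n : ℕ} (hq : IsPrimitiveRoot q n) (hn : 3 ≤ n)
  (V : Type*) [AddCommGroup V] [Module ℂ V] [Module (Uq q n) V] [IsScalarTower ℂ (Uq q n) V]
  (W : Type*) [AddCommGroup W] [Module ℂ W] [Module (Uq q n) W] [IsScalarTower ℂ (Uq q n) W]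

/-- The action of `u_q` on `V ⊗ W`: the natural action of `u_q ⊗ u_q`, restricted along `Δ`. -/
noncomputable def tensorAction : Uq q n →ₐ[ℂ] Module.End ℂ (V ⊗[ℂ] W) :=
  ((Module.endTensorEndAlgHom (R := ℂ) (S := ℂ) (A := ℂ) (M := V) (N := W)).comp
    (Algebra.TensorProduct.map (Algebra.lsmul ℂ ℂ V) (Algebra.lsmul ℂ ℂ W))).comp (comul hq hn)

/-- The tensor product over `ℂ` of two `u_q`-modules, as a `u_q`-module. -/
def TensorModule (_hq : IsPrimitiveRoot q n) (_hn : 3 ≤ n)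
    (V : Type*) [AddCommGroup V] [Module ℂ V] (W : Type*) [AddCommGroup W] [Module ℂ W] :=
  V ⊗[ℂ] W

noncomputable instance : AddCommGroup (TensorModule hq hn V W) :=
  inferInstanceAs (AddCommGroup (V ⊗[ℂ] W))

noncomputable instance : Module (Uq q n) (TensorModule hq hn V W) :=
  Module.compHom (V ⊗[ℂ] W) (tensorAction hq hn V W).toRingHom

end tensor

/-- The restriction of the `u_q`-module `V` to the subalgebra `u_q⁺` generated by `E` and `K` is
isomorphic to the indecomposable module `M_i^u`: there is a basis `e⁰, …, e^u` of `V` with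
`K eᵏ = q ^ (2 (i + k)) eᵏ`, `E eᵏ = eᵏ⁺¹` for `k < u` and `E e^u = 0`. The scalar does not depend on
the representative of `i` modulo `d`, because `q ^ (2 d) = 1`. -/
def RestrictsTo (q : ℂ) (n : ℕ) (i : ZMod (dOf n)) (u : ℕ)
    (V : Type*) [AddCommGroup V] [Module ℂ V] [Module (Uq q n) V] : Prop :=
  ∃ e : Module.Basis (Fin (u + 1)) ℂ V, ∀ k : Fin (u + 1),
    K q n • e k = q ^ (2 * (i.val + (k : ℕ))) • e k ∧
    E q n • e k = if h : (k : ℕ) + 1 < u + 1 then e ⟨k + 1, h⟩ else 0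

/-- `V` is (isomorphic to) the module `M̄_i^u`: it is a simple `u_q`-module, and it extends the
`u_q⁺`-module `M_i^u`. -/
structure IsMbar (q : ℂ) (n : ℕ) (i : ZMod (dOf n)) (u : ℕ)
    (V : Type*) [AddCommGroup V] [Module ℂ V] [Module (Uq q n) V] : Prop where
  simple : IsSimpleModule (Uq q n) V
  restrictsTo : RestrictsTo q n i u V

end SmallQuantum

/-!
Write `z = q ^ 2`, a primitive `d`-th root of unity. A vector `x` of `K`-weight `c` with
`E F x = 0` satisfies `F E ^ (k + 1) x = b_k E ^ k x` for an explicit scalar `b_k`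
(`lowerCoeff`), which vanishes exactly if `z ^ (k + 1) = 1` or `c ^ 2 z ^ k = 1`
(`lowerCoeff_eq_zero_iff`).

Let `V` be simple and extend `M_i^u`, with `c = z ^ i`. Weights leave for `F e⁰` only a multiple of
the top vector. Simplicity forces `b_k ≠ 0` for `k < u`, since a vanishing `b_k` makes the vectors
above it span a submodule; then `F ^ d = 0` forces `F e⁰ = 0`. Moreover `b_u = 0`, which forces
`c ^ 2 z ^ u = 1`, except that for `u + 1 = d` this follows from the other `b_k` being nonzero
(`IsMbar.exists_isStringBasis`). Conversely these conditions define a module, and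
it is simple because `F` is nilpotent with kernel spanned by `e⁰`
(`exists_isMbar`, `IsStringBasis.isSimpleModule`). As the condition `c ^ 2 z ^ u = 1` passes from
`(i, u)` and `(j, v)` to `(i + j + l, u + v - 2 l)`, the summands exist.

For the decomposition, write a vector of `V ⊗ W` as `∑ e_a ⊗ w_a`. It is killed by `F` iff every
`w_(a + 1)` is a certain nonzero multiple of `F w_a` and `F w_u = 0`. Since `v ≤ u`, the last
condition is automatic, so `w_0 ↦ ∑ γ_a e_a ⊗ F ^ a w_0` identifies `W` with the kernel of `F`
and multiplies weights by `c` (`lowestMap`, `exists_eq_lowestMap`). The image `x_l` of the `l`-th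
basis vector of `W` is thus a lowest weight vector with the weight of the `l`-th summand. The vector
`E ^ (u + v - 2 l + 1) x_l` is again killed by `F`, but its weight is not one of those of the kernel,
or else the exponent is `d`; so it vanishes (`E_pow_smul_lowestMap`), and `x_l` defines a
homomorphism from the `l`-th summand. The sum of these homomorphisms is injective, because a nonzero
kernel would contain a linear relation between the `x_l` (`toModule_injective`), and it is bijective
by dimension.
-/

open scoped TensorProduct DirectSum

namespace SmallQuantum

/-! ### Actions of the generators -/

theorem adjoin_range_gen (q : ℂ) (n : ℕ) : Algebra.adjoin ℂ (Set.range (gen q n)) = ⊤ := by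
  have h : Set.range (gen q n) =
      RingQuot.mkAlgHom ℂ (Rel q n) '' Set.range (FreeAlgebra.ι ℂ (X := Gen)) := by
    rw [← Set.range_comp]; rfl
  rw [h, ← AlgHom.map_adjoin, FreeAlgebra.adjoin_range_ι, Algebra.map_top, AlgHom.range_eq_top]
  exact RingQuot.mkAlgHom_surjective ℂ (Rel q n)

/-- Since `F` is nilpotent, some power of it sends a given nonzero vector to a nonzero vector
of its kernel. -/
theorem exists_F_pow_smul_ne_zero {q : ℂ} {n : ℕ} {M : Type*} [AddCommGroup M]
    [Module (Uq q n) M] {y : M} (hy : y ≠ 0) :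
    ∃ m, F q n ^ m • y ≠ 0 ∧ F q n • F q n ^ m • y = 0 := by
  classical
  have hex : ∃ m, F q n ^ m • y = 0 := ⟨dOf n, by rw [F_pow, zero_smul]⟩
  have h0 : Nat.find hex ≠ 0 := fun h => hy (by simpa [h] using Nat.find_spec hex)
  obtain ⟨m, hm⟩ := Nat.exists_eq_succ_of_ne_zero h0
  refine ⟨m, Nat.find_min hex (by omega), ?_⟩
  rw [← mul_smul, ← pow_succ', ← Nat.succ_eq_add_one, ← hm]
  exact Nat.find_spec hex

section action

variable {q : ℂ} {n : ℕ}
  {M : Type*} [AddCommGroup M] [Module ℂ M] [Module (Uq q n) M] [IsScalarTower ℂ (Uq q n) M]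
  {M' : Type*} [AddCommGroup M'] [Module ℂ M'] [Module (Uq q n) M'] [IsScalarTower ℂ (Uq q n) M']

/-- A complex subspace stable under the generators is a `u_q`-submodule. -/
def submoduleOfStable (N : Submodule ℂ M) (h : ∀ g, ∀ y ∈ N, gen q n g • y ∈ N) :
    Submodule (Uq q n) M where
  carrier := N
  add_mem' := N.add_mem
  zero_mem' := N.zero_mem
  smul_mem' a y hy := by
    have ha : a ∈ Algebra.adjoin ℂ (Set.range (gen q n)) := by
      rw [adjoin_range_gen]; trivial
    induction ha using Algebra.adjoin_induction generalizing y with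
    | mem a ha => obtain ⟨g, rfl⟩ := ha; exact h g y hy
    | algebraMap c => rw [algebraMap_smul]; exact N.smul_mem c hy
    | add a b _ _ iha ihb => rw [add_smul]; exact N.add_mem (iha y hy) (ihb y hy)
    | mul a b _ _ iha ihb => rw [mul_smul]; exact iha _ (ihb y hy)

/-- A complex linear map commuting with the generators is `u_q`-linear. -/
def homOfCommute (f : M →ₗ[ℂ] M') (h : ∀ g y, f (gen q n g • y) = gen q n g • f y) :
    M →ₗ[Uq q n] M' where
  toFun := f
  map_add' := f.map_add
  map_smul' a y := by
    have ha : a ∈ Algebra.adjoin ℂ (Set.range (gen q n)) := by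
      rw [adjoin_range_gen]; trivial
    induction ha using Algebra.adjoin_induction generalizing y with
    | mem a ha => obtain ⟨g, rfl⟩ := ha; exact h g y
    | algebraMap c => simp only [algebraMap_smul, map_smul, RingHom.id_apply]
    | add a b _ _ iha ihb =>
      simp only [add_smul, map_add, iha, ihb, RingHom.id_apply]
    | mul a b _ _ iha ihb =>
      simp only [mul_smul, iha, ihb, RingHom.id_apply]

theorem K_smul_E_smul {y : M} {c : ℂ} (h : K q n • y = c • y) :
    K q n • E q n • y = (c * q ^ 2) • E q n • y := by
  rw [← mul_smul, K_mul_E, smul_assoc, mul_smul, h, smul_comm (E q n) c, smul_smul, mul_comm]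

theorem K_smul_F_smul {y : M} {c : ℂ} (h : K q n • y = c • y) :
    K q n • F q n • y = (c * (q ^ 2)⁻¹) • F q n • y := by
  rw [← mul_smul, K_mul_F, smul_assoc, mul_smul, h, smul_comm (F q n) c, smul_smul, mul_comm]

theorem K_smul_E_pow_smul {y : M} {c : ℂ} (h : K q n • y = c • y) (k : ℕ) :
    K q n • E q n ^ k • y = (c * (q ^ 2) ^ k) • E q n ^ k • y := by
  induction k with
  | zero => simpa using h
  | succ k ih => rw [pow_succ' (E q n), mul_smul, K_smul_E_smul ih, pow_succ (q ^ 2), mul_assoc]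

theorem K_smul_F_pow_smul (y : M) (k : ℕ) :
    K q n • F q n ^ k • y = ((q ^ 2)⁻¹) ^ k • F q n ^ k • K q n • y := by
  induction k with
  | zero => simp
  | succ k ih =>
    rw [pow_succ' (F q n), mul_smul, ← mul_smul (K q n), K_mul_F, smul_assoc, mul_smul, ih,
      smul_comm (F q n), smul_smul, ← pow_succ', mul_smul (F q n)]

theorem Kinv_smul (hn : 3 ≤ n) {y : M} {c : ℂ} (hc : c ≠ 0) (h : K q n • y = c • y) :
    Kinv q n • y = c⁻¹ • y := by
  have h1 : Kinv q n * K q n = 1 := by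
    rw [Kinv, ← pow_succ, Nat.sub_add_cancel (dOf_pos hn), K_pow]
  have h2 : Kinv q n • K q n • y = y := by rw [← mul_smul, h1, one_smul]
  rw [h, smul_comm] at h2
  rw [← h2, smul_smul, inv_mul_cancel₀ hc, one_smul, h2]

/-- The scalar `b_k` with `F E^(k+1) x = b_k E^k x` for a vector `x` of `K`-weight `c` such that
`E F x = 0`. -/
noncomputable def lowerCoeff (q c : ℂ) (k : ℕ) : ℂ :=
  -(q - q⁻¹)⁻¹ * ∑ s ∈ Finset.range (k + 1), (c * (q ^ 2) ^ s - (c * (q ^ 2) ^ s)⁻¹)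

theorem lowerCoeff_succ (q c : ℂ) (k : ℕ) : lowerCoeff q c (k + 1) = lowerCoeff q c k -
    (q - q⁻¹)⁻¹ * (c * (q ^ 2) ^ (k + 1) - (c * (q ^ 2) ^ (k + 1))⁻¹) := by
  rw [lowerCoeff, Finset.sum_range_succ, lowerCoeff]
  ring

theorem lowerCoeff_zero (q c : ℂ) : lowerCoeff q c 0 = -(q - q⁻¹)⁻¹ * (c - c⁻¹) := by
  simp [lowerCoeff]

theorem F_smul_E_smul (hn : 3 ≤ n) {y : M} {c : ℂ} (hc : c ≠ 0) (h : K q n • y = c • y) :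
    F q n • E q n • y = E q n • F q n • y - ((q - q⁻¹)⁻¹ * (c - c⁻¹)) • y := by
  have h1 : (E q n * F q n - F q n * E q n) • y = ((q - q⁻¹)⁻¹ * (c - c⁻¹)) • y := by
    rw [E_mul_F_sub, smul_assoc, sub_smul, h, Kinv_smul hn hc h, ← sub_smul, smul_smul]
  rw [← h1, sub_smul, mul_smul, mul_smul]
  abel

theorem F_smul_E_pow_smul (hn : 3 ≤ n) {x : M} {c : ℂ} (hq : q ≠ 0) (hc : c ≠ 0)
    (h : K q n • x = c • x) (hx : E q n • F q n • x = 0) (k : ℕ) :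
    F q n • E q n ^ (k + 1) • x = lowerCoeff q c k • E q n ^ k • x := by
  induction k with
  | zero =>
    rw [zero_add, pow_one, F_smul_E_smul hn hc h, hx, lowerCoeff_zero]
    simp [neg_smul]
  | succ k ih =>
    have hne : c * (q ^ 2) ^ (k + 1) ≠ 0 := by positivity
    rw [pow_succ' _ (k + 1), mul_smul, F_smul_E_smul hn hne (K_smul_E_pow_smul h (k + 1)), ih,
      lowerCoeff_succ, sub_smul, smul_comm (E q n), ← mul_smul (E q n), ← pow_succ']

end action

/-! ### The scalars `lowerCoeff` -/

section coeff

variable {q : ℂ} {n : ℕ}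

theorem sq_ne_one (hq : IsPrimitiveRoot q n) (hn : 3 ≤ n) : q ^ 2 ≠ 1 :=
  hq.pow_ne_one_of_pos_of_lt (by omega) (by omega)

theorem sub_inv_ne_zero (hq : IsPrimitiveRoot q n) (hn : 3 ≤ n) : q - q⁻¹ ≠ 0 := by
  intro h
  have h0 : q ≠ 0 := hq.ne_zero (by omega)
  apply sq_ne_one hq hn
  rw [sq]
  nth_rw 2 [sub_eq_zero.1 h]
  exact mul_inv_cancel₀ h0

/-- Geometric sums give the factorization from which the zeros of `lowerCoeff` are read off. -/
theorem sum_weights {z c : ℂ} (hz : z ≠ 0) (hc : c ≠ 0) (k : ℕ) :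
    (z - 1) * (c * z ^ k) * ∑ s ∈ Finset.range (k + 1), (c * z ^ s - (c * z ^ s)⁻¹) =
      (z ^ (k + 1) - 1) * (c ^ 2 * z ^ k - 1) := by
  induction k with
  | zero => simp; field_simp
  | succ k ih =>
    rw [Finset.sum_range_succ, mul_add,
      show (z - 1) * (c * z ^ (k + 1)) * ∑ s ∈ Finset.range (k + 1), (c * z ^ s - (c * z ^ s)⁻¹) =
        z * ((z - 1) * (c * z ^ k) * ∑ s ∈ Finset.range (k + 1), (c * z ^ s - (c * z ^ s)⁻¹)) by
        ring, ih]
    field_simp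
    ring

theorem lowerCoeff_eq_zero_iff (hq : IsPrimitiveRoot q n) (hn : 3 ≤ n) {c : ℂ} (hc : c ≠ 0)
    (k : ℕ) : lowerCoeff q c k = 0 ↔ (q ^ 2) ^ (k + 1) = 1 ∨ c ^ 2 * (q ^ 2) ^ k = 1 := by
  have hz : q ^ 2 ≠ 0 := pow_ne_zero _ (hq.ne_zero (by omega))
  have h := sum_weights hz hc k
  have h1 : (q ^ 2 - 1) * (c * (q ^ 2) ^ k) ≠ 0 :=
    mul_ne_zero (sub_ne_zero.2 (sq_ne_one hq hn)) (mul_ne_zero hc (pow_ne_zero _ hz))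
  rw [lowerCoeff, mul_eq_zero, or_iff_right (neg_ne_zero.2 (inv_ne_zero (sub_inv_ne_zero hq hn))),
    ← sub_eq_zero (a := (q ^ 2) ^ (k + 1)), ← sub_eq_zero (a := c ^ 2 * (q ^ 2) ^ k),
    ← mul_eq_zero, ← h, mul_eq_zero, or_iff_right h1]

theorem lowerCoeff_ne_zero (hq : IsPrimitiveRoot q n) (hn : 3 ≤ n) {c : ℂ} {k u : ℕ}
    (hu : u < dOf n) (hcu : c ^ 2 * (q ^ 2) ^ u = 1) (hk : k < u) : lowerCoeff q c k ≠ 0 := by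
  have hc : c ≠ 0 := by rintro rfl; simp at hcu
  have hz := isPrimitiveRoot_sq hq hn
  rw [Ne, lowerCoeff_eq_zero_iff hq hn hc, not_or]
  refine ⟨hz.pow_ne_one_of_pos_of_lt (by omega) (by omega), fun h => ?_⟩
  have := hz.pow_inj (by omega) hu (mul_left_cancel₀ (pow_ne_zero 2 hc) (h.trans hcu.symm))
  omega

theorem lowerCoeff_self (hq : IsPrimitiveRoot q n) (hn : 3 ≤ n) {c : ℂ} {u : ℕ}
    (hcu : c ^ 2 * (q ^ 2) ^ u = 1) : lowerCoeff q c u = 0 := by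
  have hc : c ≠ 0 := by rintro rfl; simp at hcu
  exact (lowerCoeff_eq_zero_iff hq hn hc u).2 (Or.inr hcu)

/-- The string of weights of the `l`-th summand is again invariant under inversion. -/
theorem summand_weight {c c' z : ℂ} {u v l : ℕ} (hc : c ^ 2 * z ^ u = 1) (hc' : c' ^ 2 * z ^ v = 1)
    (hlv : l ≤ v) (hvu : v ≤ u) : (c * c' * z ^ l) ^ 2 * z ^ (u + v - 2 * l) = 1 := by
  have h1 : z ^ u * z ^ v = (z ^ l) ^ 2 * z ^ (u + v - 2 * l) := by
    simp only [← pow_add, ← pow_mul]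
    congr 1
    omega
  calc _ = c ^ 2 * c' ^ 2 * ((z ^ l) ^ 2 * z ^ (u + v - 2 * l)) := by ring
    _ = (c ^ 2 * z ^ u) * (c' ^ 2 * z ^ v) := by rw [← h1]; ring
    _ = 1 := by rw [hc, hc', one_mul]

end coeff

/-! ### String bases of simple modules -/

section string

variable {q : ℂ} {n : ℕ}
  {M : Type*} [AddCommGroup M] [Module ℂ M] [Module (Uq q n) M]
  {M' : Type*} [AddCommGroup M'] [Module ℂ M'] [Module (Uq q n) M']

/-- The basis `e` consists of the vectors `E ^ k x`, `k ≤ u`, for a lowest weight vector `x = e 0`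
of `K`-weight `c`. The condition `c ^ 2 q ^ (2 u) = 1` says that the string of weights from `c` to
`c q ^ (2 u)` is invariant under inversion. -/
structure IsStringBasis (q : ℂ) (n : ℕ) {M : Type*} [AddCommGroup M] [Module ℂ M]
    [Module (Uq q n) M] (c : ℂ) {u : ℕ} (e : Module.Basis (Fin (u + 1)) ℂ M) : Prop where
  eq_pow : ∀ k : Fin (u + 1), e k = E q n ^ (k : ℕ) • e 0
  E_pow_top : E q n ^ (u + 1) • e 0 = 0
  K_zero : K q n • e 0 = c • e 0
  F_zero : F q n • e 0 = 0
  weight : c ^ 2 * (q ^ 2) ^ u = 1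
  lt : u < dOf n

namespace IsStringBasis

variable {c : ℂ} {u : ℕ} {e : Module.Basis (Fin (u + 1)) ℂ M}

theorem weight_ne_zero (h : IsStringBasis q n c e) : c ≠ 0 := by
  rintro rfl
  simpa using h.weight

theorem E_castSucc (h : IsStringBasis q n c e) (k : Fin u) :
    E q n • e k.castSucc = e k.succ := by
  rw [h.eq_pow, h.eq_pow k.succ, ← mul_smul, ← pow_succ', Fin.val_castSucc, Fin.val_succ]

theorem E_last (h : IsStringBasis q n c e) : E q n • e (Fin.last u) = 0 := by
  rw [h.eq_pow, ← mul_smul, ← pow_succ', Fin.val_last, h.E_pow_top]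

theorem K_apply [IsScalarTower ℂ (Uq q n) M] (h : IsStringBasis q n c e) (k : Fin (u + 1)) :
    K q n • e k = (c * (q ^ 2) ^ (k : ℕ)) • e k := by
  rw [h.eq_pow, K_smul_E_pow_smul h.K_zero]

theorem F_succ [IsScalarTower ℂ (Uq q n) M] (hq : IsPrimitiveRoot q n) (hn : 3 ≤ n)
    (h : IsStringBasis q n c e) (k : Fin u) :
    F q n • e k.succ = lowerCoeff q c k • e k.castSucc := by
  rw [h.eq_pow, h.eq_pow k.castSucc, Fin.val_succ,
    F_smul_E_pow_smul hn (hq.ne_zero (by omega)) h.weight_ne_zero h.K_zero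
      (by rw [h.F_zero, smul_zero]), Fin.val_castSucc]

theorem F_pow_smul_eq_zero [IsScalarTower ℂ (Uq q n) M] (hq : IsPrimitiveRoot q n) (hn : 3 ≤ n)
    (hs : IsStringBasis q n c e) {m : ℕ} (hm : u < m) (y : M) : F q n ^ m • y = 0 := by
  suffices Algebra.lsmul ℂ ℂ M (F q n ^ m) = 0 from LinearMap.congr_fun this y
  have h : ∀ (k : ℕ) (hk : k < u + 1), F q n ^ (k + 1) • e ⟨k, hk⟩ = 0 := by
    intro k
    induction k with
    | zero => intro hk; simpa using hs.F_zero
    | succ k ih =>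
      intro hk
      have hk' : k < u := by omega
      have h1 : F q n • e ⟨k + 1, hk⟩ = lowerCoeff q c k • e ⟨k, by omega⟩ :=
        hs.F_succ hq hn ⟨k, hk'⟩
      rw [pow_succ, mul_smul, h1, smul_comm, ih, smul_zero]
  refine e.ext fun k => ?_
  change F q n ^ m • e k = 0
  obtain ⟨r, rfl⟩ : ∃ r, m = r + (k + 1) := ⟨m - (k + 1), by omega⟩
  rw [pow_add, mul_smul, h, smul_zero]

/-- The kernel of `F` is spanned by the lowest weight vector, because the scalars `lowerCoeff` below
the top of the string do not vanish. -/
theorem eq_smul_of_F_smul_eq_zero [IsScalarTower ℂ (Uq q n) M] (hq : IsPrimitiveRoot q n)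
    (hn : 3 ≤ n) (h : IsStringBasis q n c e) {y : M} (hy : F q n • y = 0) :
    y = e.repr y 0 • e 0 := by
  have h1 : F q n • y = ∑ k : Fin u, (e.repr y k.succ * lowerCoeff q c k) • e k.castSucc := by
    conv_lhs => rw [← e.sum_repr y, Fin.sum_univ_succ]
    rw [smul_add, smul_comm, h.F_zero, smul_zero, zero_add, Finset.smul_sum]
    refine Finset.sum_congr rfl fun k _ => ?_
    rw [smul_comm, h.F_succ hq hn, smul_smul]
  have hli : LinearIndependent ℂ fun k : Fin u => e k.castSucc :=
    e.linearIndependent.comp _ (Fin.castSucc_injective u)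
  have h2 := Fintype.linearIndependent_iff.1 hli _ (h1.symm.trans hy)
  conv_lhs => rw [← e.sum_repr y, Fin.sum_univ_succ]
  rw [Finset.sum_eq_zero, add_zero]
  intro k _
  rw [(mul_eq_zero.1 (h2 k)).resolve_right (lowerCoeff_ne_zero hq hn h.lt h.weight k.2), zero_smul]

theorem isSimpleModule [IsScalarTower ℂ (Uq q n) M] (hq : IsPrimitiveRoot q n)
    (hn : 3 ≤ n) (h : IsStringBasis q n c e) : IsSimpleModule (Uq q n) M := by
  have : Nontrivial M := ⟨⟨e 0, 0, e.ne_zero 0⟩⟩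
  rw [isSimpleModule_iff]
  refine ⟨fun N => ?_⟩
  rw [or_iff_not_imp_left, Submodule.eq_bot_iff]
  intro hN
  push Not at hN
  obtain ⟨y, hyN, hy⟩ := hN
  obtain ⟨m, hm, hF⟩ := exists_F_pow_smul_ne_zero (q := q) (n := n) hy
  have hmem : F q n ^ m • y ∈ N := N.smul_mem _ hyN
  have he := h.eq_smul_of_F_smul_eq_zero hq hn hF
  have hne : e.repr (F q n ^ m • y) 0 ≠ 0 := fun h0 => hm (by rw [he, h0, zero_smul])
  rw [he] at hmem
  have h0 : e 0 ∈ N := by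
    have h1 := (N.restrictScalars ℂ).smul_mem (e.repr (F q n ^ m • y) 0)⁻¹ hmem
    rwa [smul_smul, inv_mul_cancel₀ hne, one_smul] at h1
  have htop : N.restrictScalars ℂ = ⊤ := by
    rw [eq_top_iff, ← e.span_eq, Submodule.span_le]
    rintro _ ⟨k, rfl⟩
    rw [h.eq_pow]
    exact N.smul_mem _ h0
  exact (Submodule.restrictScalars_eq_top_iff ℂ (Uq q n) M).1 htop

/-- A lowest weight vector `x` of the same weight, with `E ^ (u + 1) x = 0`, is the image of the
lowest weight vector of a module with a string basis. -/
theorem exists_hom [IsScalarTower ℂ (Uq q n) M] [IsScalarTower ℂ (Uq q n) M']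
    (hq : IsPrimitiveRoot q n) (hn : 3 ≤ n)
    (h : IsStringBasis q n c e) {x : M'} (hK : K q n • x = c • x) (hF : F q n • x = 0)
    (hE : E q n ^ (u + 1) • x = 0) : ∃ f : M →ₗ[Uq q n] M', f (e 0) = x := by
  let f : M →ₗ[ℂ] M' := e.constr ℂ fun k => E q n ^ (k : ℕ) • x
  have hf : ∀ k, f (e k) = E q n ^ (k : ℕ) • x := fun k => e.constr_basis ℂ _ k
  have hcomm : ∀ g y, f (gen q n g • y) = gen q n g • f y := by
    intro g y
    suffices f ∘ₗ Algebra.lsmul ℂ ℂ M (gen q n g) = Algebra.lsmul ℂ ℂ M' (gen q n g) ∘ₗ f from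
      LinearMap.congr_fun this y
    refine e.ext fun k => ?_
    simp only [LinearMap.comp_apply, Algebra.lsmul_coe]
    cases g with
    | E =>
      induction k using Fin.lastCases with
      | last => rw [h.E_last, map_zero, hf, ← mul_smul, ← pow_succ', Fin.val_last, hE]
      | cast k => rw [h.E_castSucc, hf, hf, ← mul_smul, ← pow_succ', Fin.val_castSucc, Fin.val_succ]
    | F =>
      induction k using Fin.cases with
      | zero => rw [h.F_zero, map_zero, hf, Fin.val_zero, pow_zero, one_smul, hF]
      | succ k =>
        rw [h.F_succ hq hn, map_smul, hf, hf, Fin.val_succ,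
          F_smul_E_pow_smul hn (hq.ne_zero (by omega)) h.weight_ne_zero hK
            (by rw [hF, smul_zero]), Fin.val_castSucc]
    | K => rw [h.K_apply, map_smul, hf, K_smul_E_pow_smul hK]
  refine ⟨homOfCommute f hcomm, ?_⟩
  change f (e 0) = x
  rw [hf, Fin.val_zero, pow_zero, one_smul]

end IsStringBasis

theorem basis_eq_E_pow_smul {u : ℕ} {e : Module.Basis (Fin (u + 1)) ℂ M}
    (he : ∀ k : Fin (u + 1), E q n • e k = if h : (k : ℕ) + 1 < u + 1 then e ⟨k + 1, h⟩ else 0)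
    (k : Fin (u + 1)) : e k = E q n ^ (k : ℕ) • e 0 := by
  obtain ⟨k, hk⟩ := k
  induction k with
  | zero => simp
  | succ k ih =>
    have h1 := he ⟨k, by omega⟩
    rw [dif_pos hk, ih (by omega), ← mul_smul, ← pow_succ'] at h1
    exact h1.symm

/-- In a simple module extending `M_i^u`, the lowering scalars inside the string do not vanish:
otherwise the vectors above a vanishing one span a proper submodule. -/
theorem lowerCoeff_ne_zero_of_simple [IsScalarTower ℂ (Uq q n) M] (hq : IsPrimitiveRoot q n)
    (hn : 3 ≤ n) (hM : IsSimpleModule (Uq q n) M) {c : ℂ} (hc : c ≠ 0) {u : ℕ}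
    {e : Module.Basis (Fin (u + 1)) ℂ M}
    (he : ∀ k : Fin (u + 1), e k = E q n ^ (k : ℕ) • e 0)
    (htop : E q n ^ (u + 1) • e 0 = 0) (hK : K q n • e 0 = c • e 0)
    (hEF : E q n • F q n • e 0 = 0) {k : ℕ} (hk : k < u) : lowerCoeff q c k ≠ 0 := by
  intro h0
  let N : Submodule ℂ M := Submodule.span ℂ (e '' {m | k < (m : ℕ)})
  have hF := F_smul_E_pow_smul hn (hq.ne_zero (by omega)) hc hK hEF
  have hmem : ∀ m : ℕ, k < m → E q n ^ m • e 0 ∈ N := by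
    intro m hm
    rcases Nat.lt_or_ge m (u + 1) with hmu | hmu
    · rw [show E q n ^ m • e 0 = e ⟨m, hmu⟩ from (he ⟨m, hmu⟩).symm]
      exact Submodule.subset_span ⟨_, hm, rfl⟩
    · obtain ⟨r, rfl⟩ := Nat.exists_eq_add_of_le' hmu
      rw [pow_add, mul_smul, htop, smul_zero]
      exact N.zero_mem
  have hstable : ∀ g, ∀ y ∈ N, gen q n g • y ∈ N := by
    intro g y hy
    suffices N ≤ N.comap (Algebra.lsmul ℂ ℂ M (gen q n g)) from this hy
    rw [Submodule.span_le]
    rintro _ ⟨m, hm, rfl⟩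
    change gen q n g • e m ∈ N
    have hm' : k < (m : ℕ) := hm
    rw [he m]
    cases g with
    | E =>
      rw [← mul_smul, ← pow_succ']
      exact hmem _ (by omega)
    | F =>
      obtain ⟨r, hr⟩ := Nat.exists_eq_succ_of_ne_zero (show (m : ℕ) ≠ 0 by omega)
      rw [hr, Nat.succ_eq_add_one, hF]
      rcases Nat.lt_or_ge k r with hkr | hkr
      · exact N.smul_mem _ (hmem r hkr)
      · obtain rfl : k = r := by omega
        rw [h0, zero_smul]
        exact N.zero_mem
    | K =>
      rw [K_smul_E_pow_smul hK]
      exact N.smul_mem _ (hmem _ hm')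
  rcases eq_bot_or_eq_top (submoduleOfStable N hstable) with h | h
  · have h1 : e (Fin.last u) ∈ submoduleOfStable N hstable := Submodule.subset_span ⟨_, hk, rfl⟩
    rw [h, Submodule.mem_bot] at h1
    exact e.ne_zero _ h1
  · have h1 : e 0 ∈ submoduleOfStable N hstable := by rw [h]; trivial
    exact e.linearIndependent.notMem_span_image (s := {m : Fin (u + 1) | k < (m : ℕ)}) (x := 0)
      (by simp) h1

/-- A simple module extending `M_i^u` has a string basis. -/
theorem IsMbar.exists_isStringBasis [IsScalarTower ℂ (Uq q n) M] (hq : IsPrimitiveRoot q n)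
    (hn : 3 ≤ n) {i : ZMod (dOf n)} {u : ℕ} (hM : IsMbar q n i u M) :
    ∃ e : Module.Basis (Fin (u + 1)) ℂ M, IsStringBasis q n (q ^ (2 * i.val)) e := by
  obtain ⟨hs, e, he⟩ := hM
  have hz := isPrimitiveRoot_sq hq hn
  have hd := dOf_pos hn
  have hq0 : q ≠ 0 := hq.ne_zero (by omega)
  have hz0 : q ^ 2 ≠ 0 := pow_ne_zero _ hq0
  set c : ℂ := q ^ (2 * i.val) with hcdef
  have hc : c ≠ 0 := pow_ne_zero _ hq0
  have hcd : c ^ dOf n = 1 := by rw [hcdef, pow_mul, pow_right_comm, hz.pow_eq_one, one_pow]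
  have hpow := basis_eq_E_pow_smul fun k => (he k).2
  have hEtop : E q n • e (Fin.last u) = 0 := by rw [(he _).2, dif_neg (by simp)]
  have htop : E q n ^ (u + 1) • e 0 = 0 := by
    rw [pow_succ', mul_smul, ← hEtop, hpow (Fin.last u), Fin.val_last]
  have hK : K q n • e 0 = c • e 0 := by simpa using (he 0).1
  have hu : u < dOf n := by
    by_contra! h
    apply e.ne_zero ⟨dOf n, by omega⟩
    rw [hpow, E_pow, zero_smul]
  -- By weights, `F e 0` can only involve the top vector, and only if `u + 1 = d`.
  have hrepr : ∀ k : Fin (u + 1), (k : ℕ) + 1 ≠ dOf n → e.repr (F q n • e 0) k = 0 := by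
    intro k hk
    have h1 := K_smul_F_smul hK
    have h2 : e.repr (K q n • F q n • e 0) k =
        (c * (q ^ 2) ^ (k : ℕ)) * e.repr (F q n • e 0) k := by
      conv_lhs => rw [← e.sum_repr (F q n • e 0), Finset.smul_sum]
      have : ∀ m : Fin (u + 1), K q n • e.repr (F q n • e 0) m • e m =
          (e.repr (F q n • e 0) m * (c * (q ^ 2) ^ (m : ℕ))) • e m := by
        intro m
        rw [smul_comm, (he m).1, smul_smul, hcdef]
        congr 2
        rw [mul_add, pow_add, pow_mul q 2 m]
      rw [Finset.sum_congr rfl fun m _ => this m, e.repr_sum_self, mul_comm]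
    rw [h1, map_smul, Finsupp.smul_apply, smul_eq_mul] at h2
    by_contra hne
    have h3 := mul_left_cancel₀ hc (mul_right_cancel₀ hne h2)
    have h4 : (q ^ 2) ^ ((k : ℕ) + 1) = 1 := by
      rw [pow_succ, ← h3, inv_mul_cancel₀ hz0]
    exact hz.pow_ne_one_of_pos_of_lt (by omega) (by omega) h4
  have hFe : F q n • e 0 = e.repr (F q n • e 0) (Fin.last u) • e (Fin.last u) := by
    conv_lhs => rw [← e.sum_repr (F q n • e 0)]
    refine Finset.sum_eq_single _ (fun k _ hk => ?_) (by simp)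
    have : (k : ℕ) ≠ u := fun h => hk (Fin.ext h)
    rw [hrepr k (by omega), zero_smul]
  have hEF : E q n • F q n • e 0 = 0 := by rw [hFe, smul_comm, hEtop, smul_zero]
  have hb : ∀ k < u, lowerCoeff q c k ≠ 0 := fun k hk =>
    lowerCoeff_ne_zero_of_simple hq hn hs hc hpow htop hK hEF hk
  have hF := F_smul_E_pow_smul hn hq0 hc hK hEF
  have hbu : lowerCoeff q c u = 0 := by
    have h1 := hF u
    rw [htop, smul_zero] at h1
    refine (smul_eq_zero.1 h1.symm).resolve_right ?_
    have := e.ne_zero (Fin.last u)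
    rwa [hpow, Fin.val_last] at this
  -- If `F e 0` were nonzero, `F` would permute the lines of the string cyclically.
  have hF0 : F q n • e 0 = 0 := by
    by_cases hud : u + 1 = dOf n
    · have h1 : ∀ m ≤ u, ∃ a : ℂ, a ≠ 0 ∧ F q n ^ m • E q n ^ m • e 0 = a • e 0 := by
        intro m
        induction m with
        | zero => exact fun _ => ⟨1, one_ne_zero, by simp⟩
        | succ m ih =>
          intro hm
          obtain ⟨a, ha, h⟩ := ih (by omega)
          refine ⟨lowerCoeff q c m * a, mul_ne_zero (hb m (by omega)) ha, ?_⟩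
          rw [pow_succ (F q n), mul_smul, hF, smul_comm, h, smul_smul]
      obtain ⟨a, ha, h⟩ := h1 u le_rfl
      have h2 : F q n ^ (u + 1) • E q n ^ u • e 0 = a • F q n • e 0 := by
        rw [pow_succ', mul_smul, h, smul_comm]
      have h3 : F q n ^ (u + 1) = 0 := by rw [hud, F_pow]
      rw [h3, zero_smul] at h2
      exact (smul_eq_zero.1 h2.symm).resolve_left ha
    · rw [hFe, hrepr _ (by simpa using hud), zero_smul]
  refine ⟨e, hpow, htop, hK, hF0, ?_, hu⟩
  rcases (lowerCoeff_eq_zero_iff hq hn hc u).1 hbu with h | h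
  · -- Now `u + 1 = d`; among the powers of `q ^ 2`, only one is left for `c ^ 2`.
    have hud : dOf n = u + 1 := le_antisymm (Nat.le_of_dvd (by omega) (hz.dvd_of_pow_eq_one _ h)) hu
    have : NeZero (dOf n) := ⟨hd.ne'⟩
    obtain ⟨m, hm, hmc⟩ := hz.eq_pow_of_pow_eq_one
      (show (c ^ 2) ^ dOf n = 1 by rw [pow_right_comm, hcd, one_pow])
    have hbm : ∀ k < u, c ^ 2 * (q ^ 2) ^ k ≠ 1 := fun k hk h =>
      hb k hk ((lowerCoeff_eq_zero_iff hq hn hc k).2 (Or.inr h))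
    rcases Nat.eq_zero_or_pos m with rfl | hm0
    · rcases Nat.eq_zero_or_pos u with rfl | hu0
      · rw [← hmc]; simp
      · exact absurd (by rw [← hmc]; simp) (hbm 0 hu0)
    · have h1 : c ^ 2 * (q ^ 2) ^ (dOf n - m) = 1 := by
        rw [← hmc, ← pow_add, Nat.add_sub_cancel' hm.le, hz.pow_eq_one]
      have h2 : ¬ dOf n - m < u := fun h => hbm _ h h1
      rwa [show dOf n - m = u by omega] at h1
  · exact h

end string

/-! ### Construction of the simple modules -/

section construction

variable {q : ℂ} {n : ℕ}

/-- The standard basis of `ℂ ^ (u + 1)`, extended by zero to all natural indices. With this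
convention the formulas for the action hold for every index, without cases at the top. -/
noncomputable def stdVec (u k : ℕ) : Fin (u + 1) → ℂ :=
  if h : k < u + 1 then Pi.single ⟨k, h⟩ 1 else 0

theorem stdVec_val (u : ℕ) (k : Fin (u + 1)) :
    stdVec u k = Pi.basisFun ℂ (Fin (u + 1)) k := by
  rw [stdVec, dif_pos k.2, Pi.basisFun_apply]

theorem stdVec_of_lt {u k : ℕ} (h : u < k) : stdVec u k = 0 := dif_neg (by omega)

theorem end_ext_stdVec {u : ℕ} {f g : Module.End ℂ (Fin (u + 1) → ℂ)}
    (h : ∀ k, f (stdVec u k) = g (stdVec u k)) : f = g :=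
  (Pi.basisFun ℂ (Fin (u + 1))).ext fun k => by rw [← stdVec_val, h]

/-- The operators by which the generators act on the module with lowest `K`-weight `c` and
dimension `u + 1`. -/
noncomputable def stringOp (q c : ℂ) (u : ℕ) : Gen → Module.End ℂ (Fin (u + 1) → ℂ)
  | Gen.E => (Pi.basisFun ℂ (Fin (u + 1))).constr ℂ fun k => stdVec u (k + 1)
  | Gen.F => (Pi.basisFun ℂ (Fin (u + 1))).constr ℂ fun k =>
      if (k : ℕ) = 0 then 0 else lowerCoeff q c (k - 1) • stdVec u (k - 1)
  | Gen.K => (Pi.basisFun ℂ (Fin (u + 1))).constr ℂ fun k => (c * (q ^ 2) ^ (k : ℕ)) • stdVec u k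

theorem stringOp_E (q c : ℂ) (u k : ℕ) : stringOp q c u Gen.E (stdVec u k) = stdVec u (k + 1) := by
  rcases Nat.lt_or_ge k (u + 1) with h | h
  · rw [stdVec_val u ⟨k, h⟩, stringOp, Module.Basis.constr_basis]
  · rw [stdVec_of_lt (by omega), stdVec_of_lt (by omega), map_zero]

theorem stringOp_K (q c : ℂ) (u k : ℕ) :
    stringOp q c u Gen.K (stdVec u k) = (c * (q ^ 2) ^ k) • stdVec u k := by
  rcases Nat.lt_or_ge k (u + 1) with h | h
  · rw [stdVec_val u ⟨k, h⟩, stringOp, Module.Basis.constr_basis, ← stdVec_val]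
  · rw [stdVec_of_lt (by omega), map_zero, smul_zero]

theorem stringOp_F_zero (q c : ℂ) (u : ℕ) : stringOp q c u Gen.F (stdVec u 0) = 0 := by
  rw [show (0 : ℕ) = (0 : Fin (u + 1)) from rfl, stdVec_val, stringOp, Module.Basis.constr_basis,
    if_pos (by simp)]

theorem stringOp_F_succ (hq : IsPrimitiveRoot q n) (hn : 3 ≤ n) {c : ℂ} {u : ℕ}
    (hcu : c ^ 2 * (q ^ 2) ^ u = 1) (k : ℕ) :
    stringOp q c u Gen.F (stdVec u (k + 1)) = lowerCoeff q c k • stdVec u k := by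
  rcases Nat.lt_or_ge (k + 1) (u + 1) with h | h
  · rw [stdVec_val u ⟨k + 1, h⟩, stringOp, Module.Basis.constr_basis, if_neg (by simp)]
    rfl
  · rw [stdVec_of_lt (by omega), map_zero]
    rcases Nat.lt_or_ge u k with h' | h'
    · rw [stdVec_of_lt h', smul_zero]
    · obtain rfl : k = u := by omega
      rw [lowerCoeff_self hq hn hcu, zero_smul]

theorem stringOp_E_pow (q c : ℂ) (u m k : ℕ) :
    (stringOp q c u Gen.E ^ m) (stdVec u k) = stdVec u (k + m) := by
  induction m with
  | zero => simp
  | succ m ih => rw [pow_succ', Module.End.mul_apply, ih, stringOp_E, add_assoc]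

theorem stringOp_K_pow (q c : ℂ) (u m k : ℕ) :
    (stringOp q c u Gen.K ^ m) (stdVec u k) = (c * (q ^ 2) ^ k) ^ m • stdVec u k := by
  induction m with
  | zero => simp
  | succ m ih =>
    rw [pow_succ', Module.End.mul_apply, ih, map_smul, stringOp_K, smul_smul, ← pow_succ]

theorem stringOp_F_pow (hq : IsPrimitiveRoot q n) (hn : 3 ≤ n) {c : ℂ} {u : ℕ}
    (hcu : c ^ 2 * (q ^ 2) ^ u = 1) (m k : ℕ) (hkm : k < m) :
    (stringOp q c u Gen.F ^ m) (stdVec u k) = 0 := by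
  induction m generalizing k with
  | zero => omega
  | succ m ih =>
    rw [pow_succ, Module.End.mul_apply]
    cases k with
    | zero => rw [stringOp_F_zero, map_zero]
    | succ k => rw [stringOp_F_succ hq hn hcu, map_smul, ih k (by omega), smul_zero]

theorem stringOp_rel (hq : IsPrimitiveRoot q n) (hn : 3 ≤ n) {c : ℂ} {u : ℕ}
    (hcd : c ^ dOf n = 1) (hcu : c ^ 2 * (q ^ 2) ^ u = 1) (hu : u < dOf n)
    ⦃a b : FreeAlgebra ℂ Gen⦄ (h : Rel q n a b) :
    FreeAlgebra.lift ℂ (stringOp q c u) a = FreeAlgebra.lift ℂ (stringOp q c u) b := by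
  have hz := isPrimitiveRoot_sq hq hn
  have hq0 : q ≠ 0 := hq.ne_zero (by omega)
  have hc : c ≠ 0 := by rintro rfl; simp at hcu
  have hwd : ∀ k, (c * (q ^ 2) ^ k) ^ dOf n = 1 := fun k => by
    rw [mul_pow, hcd, pow_right_comm, hz.pow_eq_one, one_pow, one_mul]
  have hwi : ∀ k, (c * (q ^ 2) ^ k) ^ (dOf n - 1) = (c * (q ^ 2) ^ k)⁻¹ := fun k => by
    refine eq_inv_of_mul_eq_one_left ?_
    rw [← pow_succ, Nat.sub_add_cancel (dOf_pos hn), hwd]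
  refine end_ext_stdVec fun k => ?_
  cases h with
  | E_pow =>
    simp only [map_pow, FreeAlgebra.lift_ι_apply, map_zero, LinearMap.zero_apply]
    rw [stringOp_E_pow, stdVec_of_lt (by omega)]
  | F_pow =>
    simp only [map_pow, FreeAlgebra.lift_ι_apply, map_zero, LinearMap.zero_apply]
    rcases Nat.lt_or_ge u k with h | h
    · rw [stdVec_of_lt h, map_zero]
    · rw [stringOp_F_pow hq hn hcu _ _ (by omega)]
  | K_pow =>
    simp only [map_pow, FreeAlgebra.lift_ι_apply, map_one, Module.End.one_apply]
    rw [stringOp_K_pow, hwd, one_smul]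
  | K_E =>
    simp only [map_mul, map_smul, FreeAlgebra.lift_ι_apply, Module.End.mul_apply,
      LinearMap.smul_apply]
    simp only [stringOp_E, stringOp_K, map_smul, smul_smul]
    congr 1
    ring
  | K_F =>
    simp only [map_mul, map_smul, FreeAlgebra.lift_ι_apply, Module.End.mul_apply,
      LinearMap.smul_apply]
    cases k with
    | zero => simp only [stringOp_F_zero, stringOp_K, map_smul, map_zero, smul_zero]
    | succ k =>
      simp only [stringOp_F_succ hq hn hcu, stringOp_K, map_smul, smul_smul]
      congr 1
      rw [pow_succ (q ^ 2)]
      field_simp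
  | E_F =>
    simp only [map_mul, map_sub, map_smul, map_pow, FreeAlgebra.lift_ι_apply,
      Module.End.mul_apply, LinearMap.smul_apply, LinearMap.sub_apply]
    rw [stringOp_K_pow, hwi, stringOp_K, stringOp_E, stringOp_F_succ hq hn hcu]
    cases k with
    | zero =>
      rw [stringOp_F_zero, map_zero, lowerCoeff_zero, zero_sub, ← neg_smul, ← sub_smul, smul_smul,
        pow_zero, mul_one]
      congr 1
      ring
    | succ k =>
      rw [stringOp_F_succ hq hn hcu, map_smul, stringOp_E, lowerCoeff_succ, ← sub_smul, ← sub_smul,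
        smul_smul]
      congr 1
      ring

/-- The representation of `u_q` on `ℂ ^ (u + 1)` with lowest `K`-weight `c`. -/
noncomputable def stringRep (hq : IsPrimitiveRoot q n) (hn : 3 ≤ n) {c : ℂ} {u : ℕ}
    (hcd : c ^ dOf n = 1) (hcu : c ^ 2 * (q ^ 2) ^ u = 1) (hu : u < dOf n) :
    Uq q n →ₐ[ℂ] Module.End ℂ (Fin (u + 1) → ℂ) :=
  RingQuot.liftAlgHom ℂ ⟨FreeAlgebra.lift ℂ (stringOp q c u), stringOp_rel hq hn hcd hcu hu⟩

theorem stringRep_gen (hq : IsPrimitiveRoot q n) (hn : 3 ≤ n) {c : ℂ} {u : ℕ}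
    (hcd : c ^ dOf n = 1) (hcu : c ^ 2 * (q ^ 2) ^ u = 1) (hu : u < dOf n) (g : Gen) :
    stringRep hq hn hcd hcu hu (gen q n g) = stringOp q c u g := by
  rw [stringRep, gen, RingQuot.liftAlgHom_mkAlgHom_apply, FreeAlgebra.lift_ι_apply]

theorem IsStringBasis.isMbar {M : Type*} [AddCommGroup M] [Module ℂ M] [Module (Uq q n) M]
    [IsScalarTower ℂ (Uq q n) M] (hq : IsPrimitiveRoot q n) (hn : 3 ≤ n) {i : ZMod (dOf n)} {u : ℕ}
    {e : Module.Basis (Fin (u + 1)) ℂ M} (h : IsStringBasis q n (q ^ (2 * i.val)) e) :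
    IsMbar q n i u M := by
  refine ⟨h.isSimpleModule hq hn, e, fun k => ⟨?_, ?_⟩⟩
  · rw [h.K_apply, mul_add, pow_add, pow_mul q 2 k]
  · induction k using Fin.lastCases with
    | last => rw [h.E_last, dif_neg (by simp)]
    | cast k =>
      rw [h.E_castSucc, dif_pos (by simp)]
      rfl

/-- The module of lowest weight `q ^ (2 i)` and dimension `u + 1` exists when its string of weights is
invariant under inversion. -/
theorem exists_isMbar (hq : IsPrimitiveRoot q n) (hn : 3 ≤ n) (i : ZMod (dOf n)) {u : ℕ}
    (hw : (q ^ (2 * i.val)) ^ 2 * (q ^ 2) ^ u = 1) (hu : u < dOf n) :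
    ∃ (L : Type) (_ : AddCommGroup L) (_ : Module ℂ L) (_ : Module (Uq q n) L)
      (_ : IsScalarTower ℂ (Uq q n) L), IsMbar q n i u L := by
  have hz := isPrimitiveRoot_sq hq hn
  have hcd : (q ^ (2 * i.val)) ^ dOf n = 1 := by
    rw [pow_mul, pow_right_comm, hz.pow_eq_one, one_pow]
  let ρ := stringRep hq hn hcd hw hu
  let _ : Module (Uq q n) (Fin (u + 1) → ℂ) := Module.compHom _ ρ.toRingHom
  have htower : IsScalarTower ℂ (Uq q n) (Fin (u + 1) → ℂ) :=
    ⟨fun a x y => by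
      change ρ (a • x) y = a • ρ x y
      rw [map_smul, LinearMap.smul_apply]⟩
  have hgen : ∀ (g : Gen) (y : Fin (u + 1) → ℂ),
      gen q n g • y = stringOp q (q ^ (2 * i.val)) u g y := fun g y =>
    LinearMap.congr_fun (stringRep_gen hq hn hcd hw hu g) y
  have hpow : ∀ m : ℕ, E q n ^ m • stdVec u 0 = stdVec u m := by
    intro m
    induction m with
    | zero => simp
    | succ m ih => rw [pow_succ', mul_smul, ih, hgen, stringOp_E]
  have h0 : Pi.basisFun ℂ (Fin (u + 1)) 0 = stdVec u 0 := (stdVec_val u 0).symm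
  refine ⟨Fin (u + 1) → ℂ, inferInstance, inferInstance, inferInstance, htower,
    IsStringBasis.isMbar hq hn (e := Pi.basisFun ℂ (Fin (u + 1)))
      ⟨fun k => ?_, ?_, ?_, ?_, hw, hu⟩⟩
  · rw [h0, hpow, stdVec_val]
  · rw [h0, hpow, stdVec_of_lt (by omega)]
  · rw [h0, hgen, stringOp_K, pow_zero, mul_one]
  · rw [h0, hgen, stringOp_F_zero]

end construction

/-! ### Lowest weight vectors in a tensor product -/

section tensorProduct

variable {q : ℂ} {n : ℕ} (hq : IsPrimitiveRoot q n) (hn : 3 ≤ n)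
  {V : Type*} [AddCommGroup V] [Module ℂ V] [Module (Uq q n) V] [IsScalarTower ℂ (Uq q n) V]
  {W : Type*} [AddCommGroup W] [Module ℂ W] [Module (Uq q n) W] [IsScalarTower ℂ (Uq q n) W]

noncomputable instance : Module ℂ (TensorModule hq hn V W) :=
  inferInstanceAs (Module ℂ (V ⊗[ℂ] W))

instance : IsScalarTower ℂ (Uq q n) (TensorModule hq hn V W) :=
  ⟨fun a x y => by
    change tensorAction hq hn V W (a • x) y = a • tensorAction hq hn V W x y
    exact LinearMap.congr_fun (map_smul (tensorAction hq hn V W) a x) y⟩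

/-- The canonical bilinear map into the tensor product module. -/
def tensorMk (V W : Type*) [AddCommGroup V] [Module ℂ V] [AddCommGroup W] [Module ℂ W] :
    V →ₗ[ℂ] W →ₗ[ℂ] TensorModule hq hn V W :=
  TensorProduct.mk ℂ V W

theorem F_smul_tensorMk (a : V) (b : W) : F q n • tensorMk hq hn V W a b =
    tensorMk hq hn V W (Kinv q n • a) (F q n • b) + tensorMk hq hn V W (F q n • a) b := by
  change tensorAction hq hn V W (gen q n Gen.F) (a ⊗ₜ[ℂ] b) = _
  simp only [tensorAction, AlgHom.comp_apply, comul, gen, RingQuot.liftAlgHom_mkAlgHom_apply,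
    FreeAlgebra.lift_ι_apply, comulGen, map_add, Algebra.TensorProduct.map_tmul, LinearMap.add_apply,
    Module.endTensorEndAlgHom_apply, TensorProduct.AlgebraTensorModule.map_tmul, map_one,
    Module.End.one_apply, Algebra.lsmul_coe]
  rfl

theorem K_smul_tensorMk (a : V) (b : W) : K q n • tensorMk hq hn V W a b =
    tensorMk hq hn V W (K q n • a) (K q n • b) := by
  change tensorAction hq hn V W (gen q n Gen.K) (a ⊗ₜ[ℂ] b) = _
  simp only [tensorAction, AlgHom.comp_apply, comul, gen, RingQuot.liftAlgHom_mkAlgHom_apply,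
    FreeAlgebra.lift_ι_apply, comulGen, Algebra.TensorProduct.map_tmul,
    Module.endTensorEndAlgHom_apply, TensorProduct.AlgebraTensorModule.map_tmul,
    Algebra.lsmul_coe]
  rfl

omit [Module (Uq q n) V] [IsScalarTower ℂ (Uq q n) V] [Module (Uq q n) W]
  [IsScalarTower ℂ (Uq q n) W] in
theorem exists_eq_sum_tensorMk {ι : Type*} [Fintype ι] (e : Module.Basis ι ℂ V)
    (y : TensorModule hq hn V W) : ∃ w : ι → W, y = ∑ a, tensorMk hq hn V W (e a) (w a) := by
  obtain ⟨w, hw⟩ := TensorProduct.eq_repr_basis_left (N := W) e y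
  refine ⟨w, hw.symm.trans ?_⟩
  rw [Finsupp.sum_fintype _ _ (by simp)]
  rfl

omit [Module (Uq q n) V] [IsScalarTower ℂ (Uq q n) V] [Module (Uq q n) W]
  [IsScalarTower ℂ (Uq q n) W] in
theorem eq_zero_of_sum_tensorMk_eq_zero {ι : Type*} [Fintype ι] (e : Module.Basis ι ℂ V) {w : ι → W}
    (h : ∑ a, tensorMk hq hn V W (e a) (w a) = 0) (a : ι) : w a = 0 := by
  have h1 := TensorProduct.sum_tmul_basis_left_eq_zero (N := W) e (Finsupp.equivFunOnFinite.symm w)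
    (by
      rw [Finsupp.sum_fintype _ _ (by simp)]
      exact h)
  exact DFunLike.congr_fun h1 a

variable {c : ℂ} {u : ℕ} {e : Module.Basis (Fin (u + 1)) ℂ V}

theorem F_smul_sum_tensorMk (he : IsStringBasis q n c e) (w : Fin (u + 1) → W) :
    F q n • ∑ a, tensorMk hq hn V W (e a) (w a) =
      (∑ a : Fin u, tensorMk hq hn V W (e a.castSucc)
        ((c * (q ^ 2) ^ (a : ℕ))⁻¹ • F q n • w a.castSucc + lowerCoeff q c a • w a.succ)) +
      tensorMk hq hn V W (e (Fin.last u)) ((c * (q ^ 2) ^ u)⁻¹ • F q n • w (Fin.last u)) := by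
  have hq0 : q ≠ 0 := hq.ne_zero (by omega)
  have hc := he.weight_ne_zero
  have hKi : ∀ a : Fin (u + 1), Kinv q n • e a = (c * (q ^ 2) ^ (a : ℕ))⁻¹ • e a := fun a =>
    Kinv_smul hn (by positivity) (he.K_apply a)
  simp only [Finset.smul_sum, F_smul_tensorMk, Finset.sum_add_distrib, hKi, map_smul,
    LinearMap.smul_apply, map_add]
  rw [Fin.sum_univ_castSucc, Fin.sum_univ_succ (fun a => tensorMk hq hn V W (F q n • e a) (w a))]
  simp only [he.F_zero, he.F_succ hq hn, map_zero, LinearMap.zero_apply, map_smul,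
    LinearMap.smul_apply, Fin.val_castSucc, Fin.val_last, zero_add]
  abel

/-- The coefficients `γ_a` for which `∑ a, γ_a e_a ⊗ F ^ a w` is killed by `F`. -/
noncomputable def lowestCoeff (q c : ℂ) : ℕ → ℂ
  | 0 => 1
  | a + 1 => -((c * (q ^ 2) ^ a)⁻¹ * (lowerCoeff q c a)⁻¹ * lowestCoeff q c a)

/-- The map `w ↦ ∑ a, γ_a e_a ⊗ F ^ a w` from the second factor to the tensor product. -/
noncomputable def lowestMap (e : Module.Basis (Fin (u + 1)) ℂ V) (c : ℂ) (W : Type*)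
    [AddCommGroup W] [Module ℂ W] [Module (Uq q n) W] [IsScalarTower ℂ (Uq q n) W] :
    W →ₗ[ℂ] TensorModule hq hn V W :=
  ∑ a : Fin (u + 1), tensorMk hq hn V W (e a) ∘ₗ
    (lowestCoeff q c a • Algebra.lsmul ℂ ℂ W (F q n ^ (a : ℕ)))

omit [Module (Uq q n) V] [IsScalarTower ℂ (Uq q n) V] in
theorem lowestMap_apply (w : W) : lowestMap hq hn e c W w =
    ∑ a : Fin (u + 1), tensorMk hq hn V W (e a) (lowestCoeff q c a • F q n ^ (a : ℕ) • w) := by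
  simp only [lowestMap, LinearMap.sum_apply, LinearMap.comp_apply, LinearMap.smul_apply,
    Algebra.lsmul_coe]

/-- Applying `F` telescopes the sum to a multiple of `e_u ⊗ F ^ (u + 1) w`. -/
theorem F_smul_lowestMap (he : IsStringBasis q n c e) {w : W} (hw : F q n ^ (u + 1) • w = 0) :
    F q n • lowestMap hq hn e c W w = 0 := by
  rw [lowestMap_apply, F_smul_sum_tensorMk hq hn he, Finset.sum_eq_zero, zero_add, Fin.val_last,
    smul_comm (F q n), ← mul_smul (F q n), ← pow_succ', hw, smul_zero, smul_zero, map_zero]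
  intro a _
  have hb := lowerCoeff_ne_zero hq hn he.lt he.weight a.2
  rw [smul_comm (F q n), Fin.val_castSucc, Fin.val_succ, ← mul_smul (F q n), ← pow_succ', smul_smul,
    smul_smul, ← add_smul, lowestCoeff]
  suffices h : (c * (q ^ 2) ^ (a : ℕ))⁻¹ * lowestCoeff q c a + lowerCoeff q c a *
      -((c * (q ^ 2) ^ (a : ℕ))⁻¹ * (lowerCoeff q c a)⁻¹ * lowestCoeff q c a) = 0 by
    rw [h, zero_smul, map_zero]
  field_simp
  ring

/-- The image of `lowestMap` contains every vector killed by `F`: comparing the components along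
`e_a` shows that the component along `e 0` determines such a vector. -/
theorem exists_eq_lowestMap (he : IsStringBasis q n c e) {y : TensorModule hq hn V W}
    (hy : F q n • y = 0) : ∃ w, y = lowestMap hq hn e c W w := by
  obtain ⟨w, rfl⟩ := exists_eq_sum_tensorMk hq hn e y
  rw [F_smul_sum_tensorMk hq hn he] at hy
  have h := eq_zero_of_sum_tensorMk_eq_zero hq hn e (w := Fin.snoc (α := fun _ => W)
    (fun a : Fin u =>
      (c * (q ^ 2) ^ (a : ℕ))⁻¹ • F q n • w a.castSucc + lowerCoeff q c a • w a.succ)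
    ((c * (q ^ 2) ^ u)⁻¹ • F q n • w (Fin.last u)))
    (by
      rw [Fin.sum_univ_castSucc]
      simpa only [Fin.snoc_castSucc, Fin.snoc_last] using hy)
  have hw : ∀ a : Fin (u + 1), w a = lowestCoeff q c a • F q n ^ (a : ℕ) • w 0 := by
    intro a
    induction a using Fin.induction with
    | zero => simp [lowestCoeff]
    | succ a ih =>
      have hb := lowerCoeff_ne_zero hq hn he.lt he.weight a.2
      have h1 := h a.castSucc
      rw [Fin.snoc_castSucc, ih, add_comm, add_eq_zero_iff_eq_neg, Fin.val_castSucc,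
        smul_comm (F q n), ← mul_smul (F q n), ← pow_succ', smul_smul, ← neg_smul] at h1
      rw [← inv_smul_smul₀ hb (w a.succ), h1, smul_smul, Fin.val_succ, lowestCoeff]
      congr 1
      ring
  refine ⟨w 0, ?_⟩
  rw [lowestMap_apply]
  exact Finset.sum_congr rfl fun a _ => by rw [← hw]

omit [Module (Uq q n) V] [IsScalarTower ℂ (Uq q n) V] in
/-- The component of `lowestMap w` along `e 0` is `w`. -/
theorem lowestMap_injective : Function.Injective (lowestMap hq hn e c W) := by
  rw [injective_iff_map_eq_zero]
  intro w hw
  rw [lowestMap_apply] at hw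
  simpa [lowestCoeff] using eq_zero_of_sum_tensorMk_eq_zero hq hn e hw 0

theorem K_smul_lowestMap (he : IsStringBasis q n c e) (w : W) :
    K q n • lowestMap hq hn e c W w = c • lowestMap hq hn e c W (K q n • w) := by
  have hq0 : q ≠ 0 := hq.ne_zero (by omega)
  rw [lowestMap_apply, lowestMap_apply, Finset.smul_sum, Finset.smul_sum]
  refine Finset.sum_congr rfl fun a _ => ?_
  rw [K_smul_tensorMk, he.K_apply, smul_comm (K q n), K_smul_F_pow_smul]
  generalize F q n ^ (a : ℕ) • K q n • w = t
  simp only [map_smul, LinearMap.smul_apply, smul_smul, inv_pow]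
  congr 1
  field_simp

variable {c' : ℂ} {v : ℕ} {f : Module.Basis (Fin (v + 1)) ℂ W}

/-- The lowest weight vector attached to `f l` generates a string of length at most
`u + v - 2 l + 1`: the next vector is killed by `F`, hence comes from the second factor, but its
weight does not occur there. -/
theorem E_pow_smul_lowestMap (he : IsStringBasis q n c e) (hf : IsStringBasis q n c' f)
    (hvu : v ≤ u) (huv : u + v < dOf n) (l : Fin (v + 1)) :
    E q n ^ (u + v - 2 * l + 1) • lowestMap hq hn e c W (f l) = 0 := by
  have hz := isPrimitiveRoot_sq hq hn
  have hq0 : q ≠ 0 := hq.ne_zero (by omega)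
  have hc := he.weight_ne_zero
  have hc' := hf.weight_ne_zero
  have hl : (l : ℕ) ≤ v := by omega
  obtain ⟨r, hr⟩ : ∃ r, u + v - 2 * (l : ℕ) = r := ⟨_, rfl⟩
  rw [hr]
  set x := lowestMap hq hn e c W (f l) with hx
  have hK : K q n • x = (c * (c' * (q ^ 2) ^ (l : ℕ))) • x := by
    rw [hx, K_smul_lowestMap hq hn he, hf.K_apply, map_smul, smul_smul]
  have hF : F q n • x = 0 :=
    F_smul_lowestMap hq hn he (hf.F_pow_smul_eq_zero hq hn (by omega) _)
  -- For `r + 1 = d` the weight of `E ^ (r + 1) x` wraps around, but then `E ^ d = 0` applies.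
  by_cases hlast : r + 1 = dOf n
  · rw [hlast, E_pow, zero_smul]
  have hw : (c * (c' * (q ^ 2) ^ (l : ℕ))) ^ 2 * (q ^ 2) ^ r = 1 := by
    rw [← mul_assoc, ← hr]
    exact summand_weight he.weight hf.weight hl hvu
  have hFy : F q n • E q n ^ (r + 1) • x = 0 := by
    rw [F_smul_E_pow_smul hn hq0 (by positivity) hK (by rw [hF, smul_zero]),
      lowerCoeff_self hq hn hw, zero_smul]
  have hKy := K_smul_E_pow_smul hK (r + 1)
  obtain ⟨w, hyw⟩ := exists_eq_lowestMap hq hn he hFy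
  rw [hyw, K_smul_lowestMap hq hn he, ← map_smul, ← map_smul] at hKy
  have hKw := lowestMap_injective hq hn hKy
  have hw0 : w = 0 := by
    refine f.repr.map_eq_zero_iff.1 (Finsupp.ext fun k => ?_)
    have h1 : K q n • w = ∑ m, (f.repr w m * (c' * (q ^ 2) ^ (m : ℕ))) • f m := by
      conv_lhs => rw [← f.sum_repr w, Finset.smul_sum]
      exact Finset.sum_congr rfl fun m _ => by rw [smul_comm, hf.K_apply, smul_smul]
    have h2 := congrArg (fun y => f.repr y k) hKw
    simp only [h1, map_smul, Finsupp.smul_apply, smul_eq_mul, f.repr_sum_self] at h2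
    by_contra hne
    have h3 : (q ^ 2) ^ (k : ℕ) = (q ^ 2) ^ ((l : ℕ) + (r + 1)) := by
      have h4 : (c * c' * f.repr w k) * (q ^ 2) ^ (k : ℕ) =
          (c * c' * f.repr w k) * (q ^ 2) ^ ((l : ℕ) + (r + 1)) := by
        rw [pow_add]
        linear_combination h2
      exact mul_left_cancel₀ (mul_ne_zero (mul_ne_zero hc hc') hne) h4
    have := hz.pow_inj (by omega) (by omega) h3
    omega
  rw [hyw, hw0, map_zero]

end tensorProduct

/-! ### Weights and dimensions of the summands -/

section summands

variable {q : ℂ} {n : ℕ}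

theorem weight_add (hq : IsPrimitiveRoot q n) (hn : 3 ≤ n) (i j : ZMod (dOf n)) :
    q ^ (2 * (i + j).val) = q ^ (2 * i.val) * q ^ (2 * j.val) := by
  have : NeZero (dOf n) := ⟨(dOf_pos hn).ne'⟩
  rw [pow_mul, pow_mul, pow_mul, ← pow_add, ZMod.val_add,
    ← pow_mod_orderOf _ (i.val + j.val), ← (isPrimitiveRoot_sq hq hn).eq_orderOf]

theorem weight_natCast (hq : IsPrimitiveRoot q n) (hn : 3 ≤ n) (l : ℕ) :
    q ^ (2 * (l : ZMod (dOf n)).val) = (q ^ 2) ^ l := by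
  rw [pow_mul, ZMod.val_natCast, ← pow_mod_orderOf _ l, ← (isPrimitiveRoot_sq hq hn).eq_orderOf]

theorem sum_range_string_lengths (u v : ℕ) (hvu : v ≤ u) :
    ∑ l ∈ Finset.range (v + 1), (u + v - 2 * l + 1) = (u + 1) * (v + 1) := by
  obtain ⟨t, rfl⟩ := Nat.exists_eq_add_of_le hvu
  induction v with
  | zero => simp
  | succ v ih =>
    rw [Finset.sum_range_succ']
    have h : ∀ l ∈ Finset.range (v + 1), v + 1 + t + (v + 1) - 2 * (l + 1) + 1 =
        v + t + v - 2 * l + 1 := fun l _ => by omega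
    rw [Finset.sum_congr rfl h, ih (by omega)]
    simp only [mul_zero, Nat.sub_zero]
    ring

end summands

/-! ### The decomposition -/

section decomposition

variable {q : ℂ} {n : ℕ}

/-- A homomorphism out of a direct sum of modules with string bases is injective as soon as the
images of the lowest weight vectors are linearly independent: by nilpotency of `F`, a nonzero kernel
would contain a nonzero vector killed by `F`, that is, a combination of lowest weight vectors. -/
theorem toModule_injective (hq : IsPrimitiveRoot q n) (hn : 3 ≤ n) {ι : Type*} [Fintype ι]
    [DecidableEq ι] (L : ι → Type*) [∀ l, AddCommGroup (L l)] [∀ l, Module ℂ (L l)]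
    [∀ l, Module (Uq q n) (L l)] [∀ l, IsScalarTower ℂ (Uq q n) (L l)]
    {M : Type*} [AddCommGroup M] [Module ℂ M] [Module (Uq q n) M] [IsScalarTower ℂ (Uq q n) M]
    (c : ι → ℂ) (r : ι → ℕ) (g : ∀ l, Module.Basis (Fin (r l + 1)) ℂ (L l))
    (hg : ∀ l, IsStringBasis q n (c l) (g l)) (φ : ∀ l, L l →ₗ[Uq q n] M)
    (hφ : LinearIndependent ℂ fun l => φ l (g l 0)) :
    Function.Injective (DirectSum.toModule (Uq q n) ι M φ) := by
  rw [injective_iff_map_eq_zero]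
  intro y hy
  by_contra hy0
  obtain ⟨m, hm, hF⟩ := exists_F_pow_smul_ne_zero (q := q) (n := n) hy0
  set t := F q n ^ m • y with ht
  have hφt : DirectSum.toModule (Uq q n) ι M φ t = 0 := by rw [ht, map_smul, hy, smul_zero]
  have hcomp : ∀ l, t l = (g l).repr (t l) 0 • g l 0 := fun l =>
    (hg l).eq_smul_of_F_smul_eq_zero hq hn (by
      have := DFunLike.congr_fun hF l
      rwa [DirectSum.smul_apply] at this)
  have hsum : ∑ l, (g l).repr (t l) 0 • φ l (g l 0) = 0 := by
    rw [← hφt]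
    conv_rhs => rw [← DirectSum.sum_univ_of t, map_sum]
    refine Finset.sum_congr rfl fun l _ => ?_
    have h1 : DirectSum.toModule (Uq q n) ι M φ (DirectSum.of L l (t l)) = φ l (t l) :=
      DirectSum.toModule_lof (Uq q n) l (t l)
    rw [h1]
    conv_rhs => rw [hcomp l]
    exact ((φ l).map_smul_of_tower _ _).symm
  have hzero := Fintype.linearIndependent_iff.1 hφ _ hsum
  apply hm
  refine DFinsupp.ext fun l => ?_
  rw [hcomp l, hzero l, zero_smul]
  rfl

end decomposition

end SmallQuantum

open SmallQuantum in
theorem theorem5p1 {q : ℂ} {n : ℕ} (hq : IsPrimitiveRoot q n) (hn : 3 ≤ n) (hn4 : n ≠ 4)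
    (i j : ZMod (SmallQuantum.dOf n)) (u v : ℕ)
    (huv : u + v ≤ SmallQuantum.dOf n - 1) (hvu : v ≤ u)
    (V : Type*) [AddCommGroup V] [Module ℂ V] [Module (SmallQuantum.Uq q n) V]
    [IsScalarTower ℂ (SmallQuantum.Uq q n) V] (hV : SmallQuantum.IsMbar q n i u V)
    (W : Type*) [AddCommGroup W] [Module ℂ W] [Module (SmallQuantum.Uq q n) W]
    [IsScalarTower ℂ (SmallQuantum.Uq q n) W] (hW : SmallQuantum.IsMbar q n j v W) :
    -- the modules on the right-hand side exist
    (∀ l : Fin (v + 1), ∃ (L : Type) (_ : AddCommGroup L) (_ : Module ℂ L)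
      (_ : Module (SmallQuantum.Uq q n) L) (_ : IsScalarTower ℂ (SmallQuantum.Uq q n) L),
      SmallQuantum.IsMbar q n (i + j + ((l : ℕ) : ZMod (SmallQuantum.dOf n))) (u + v - 2 * l) L) ∧
    -- and whatever modules `L l` represent them, the tensor product is their direct sum
    ∀ (L : Fin (v + 1) → Type*) [∀ l, AddCommGroup (L l)] [∀ l, Module ℂ (L l)]
      [∀ l, Module (SmallQuantum.Uq q n) (L l)] [∀ l, IsScalarTower ℂ (SmallQuantum.Uq q n) (L l)],
      (∀ l : Fin (v + 1), SmallQuantum.IsMbar q n (i + j + ((l : ℕ) : ZMod (SmallQuantum.dOf n)))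
        (u + v - 2 * l) (L l)) →
      Nonempty (SmallQuantum.TensorModule hq hn V W ≃ₗ[SmallQuantum.Uq q n] ⨁ l, L l) := by
  obtain ⟨e, he⟩ := hV.exists_isStringBasis hq hn
  obtain ⟨f, hf⟩ := hW.exists_isStringBasis hq hn
  have hd := dOf_pos hn
  have hwt : ∀ l : ℕ, q ^ (2 * (i + j + (l : ZMod (dOf n))).val) =
      q ^ (2 * i.val) * q ^ (2 * j.val) * (q ^ 2) ^ l := fun l => by
    rw [weight_add hq hn, weight_add hq hn, weight_natCast hq hn]
  refine ⟨fun l => exists_isMbar hq hn _ ?_ (by omega), ?_⟩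
  · rw [hwt]
    exact summand_weight he.weight hf.weight (by omega) hvu
  intro L _ _ _ _ hL
  choose g hg using fun l => (hL l).exists_isStringBasis hq hn
  let x : Fin (v + 1) → TensorModule hq hn V W := fun l =>
    lowestMap hq hn e (q ^ (2 * i.val)) W (f l)
  have hφ : ∀ l, ∃ φ : L l →ₗ[Uq q n] TensorModule hq hn V W, φ (g l 0) = x l := fun l => by
    refine (hg l).exists_hom hq hn ?_ ?_ (E_pow_smul_lowestMap hq hn he hf hvu (by omega) l)
    · rw [K_smul_lowestMap hq hn he, hf.K_apply, map_smul, smul_smul, hwt, mul_assoc]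
    · exact F_smul_lowestMap hq hn he (hf.F_pow_smul_eq_zero hq hn (by omega) _)
  choose φ hφ using hφ
  let Φ := DirectSum.toModule (Uq q n) (Fin (v + 1)) (TensorModule hq hn V W) φ
  have hinj : Function.Injective Φ := by
    refine toModule_injective hq hn L _ _ g hg φ ?_
    simp only [hφ]
    exact f.linearIndependent.map' _ (LinearMap.ker_eq_bot.2 (lowestMap_injective hq hn))
  have hfinL : ∀ l, Module.Finite ℂ (L l) := fun l => Module.Finite.of_basis (g l)
  have hfinT : Module.Finite ℂ (TensorModule hq hn V W) :=
    Module.Finite.of_basis (e.tensorProduct f)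
  have hdimT : Module.finrank ℂ (TensorModule hq hn V W) = (u + 1) * (v + 1) := by
    refine (Module.finrank_eq_card_basis (e.tensorProduct f)).trans ?_
    simp
  have hdimL : Module.finrank ℂ (⨁ l, L l) = (u + 1) * (v + 1) := by
    rw [Module.finrank_directSum, ← sum_range_string_lengths u v hvu, ← Fin.sum_univ_eq_sum_range
      (fun l => u + v - 2 * l + 1)]
    refine Finset.sum_congr rfl fun l _ => ?_
    rw [Module.finrank_eq_card_basis (g l), Fintype.card_fin]
  have hfin : Module.Finite ℂ (⨁ l, L l) :=
    Module.Finite.of_injective (Φ.restrictScalars ℂ) hinj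
  have hsurj : Function.Surjective Φ :=
    (LinearMap.injective_iff_surjective_of_finrank_eq_finrank (f := Φ.restrictScalars ℂ)
      (hdimL.trans hdimT.symm)).1 hinj
  exact ⟨(LinearEquiv.ofBijective Φ ⟨hinj, hsurj⟩).symm⟩
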